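/- A tropical curve $\Gamma$ is the underlying space of a finite connected nonempty multigraph (loops allowed) with edge lengths in $\mathbb R_{>0}\cup\{\infty\}$, where each edge $e$ is identified with the interval $[0,l(e)]$, and where the length $\infty$ is allowed only on leaf edges, whose leaf end is then the point $\infty$ (a point at infinity). It carries the path distance, with values in $[0,\infty]$. Such a graph with lengths is called a model of $\Gamma$. A rational function on $\Gamma$ is either the constant $-\infty$ or a continuous map $f:\Gamma\to\mathbb R\cup\{\pm\infty\}$ that is piecewise affine with integer slopes and finitely many pieces and takes the values $\pm\infty$ only at points at infinity. For a point $p$ that is not at infinity and $\varepsilon\in(0,\infty]$, the chip-firing move is the function $\operatorname{CF}(\{p\},\varepsilon)(x)=-\min(\varepsilon,\operatorname{dist}(x,p))$. A continuous map $\varphi:\Gamma\to\Gamma'$ of tropical curves is a finite harmonic morphism if there are loopless models of $\Gamma$ and $\Gamma'$ such that $\varphi$ maps vertices to vertices and edges onto edges, multiplies distances on each edge $e$ by a positive integer $\deg_e(\varphi)$, and, for every vertex $v$, the sum $\deg_v(\varphi)$ of $\deg_e(\varphi)$ over the edges $e\ni v$ with $\varphi(e)=e'$ is the same for all edges $e'\ni\varphi(v)$;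 its degree is $\sum_{v\mapsto v'}\deg_v(\varphi)$ for any vertex $v'$ of $\Gamma'$ (a map between singletons is regarded as having every degree). Let a finite group $G$ act continuously on $\Gamma$ and isometrically away from the points at infinity. The map $\varphi$ is $G$-Galois if it is a finite harmonic morphism of degree $|G|$, $G$ acts transitively on every fibre of $\varphi$, and all but finitely many points of $\Gamma$ have trivial stabilizer in $G$. The group $G$ acts on functions on $\Gamma$ by $(g\cdot f)(x)=f(g^{-1}x)$. For a subgroup $H\le G$, the quotient $\Gamma/H$, with projection $\pi_H:\Gamma\to\Gamma/H$, is given the path distance in which the image of an edge $e$ of a model of $\Gamma$ has its length multiplied by the order $|H_e|$ of the group of elements of $H$ fixing $e$. **Proposition.** Let $\varphi:\Gamma\to\Gamma'$ be a map between tropical curves and $G$ a finite group acting isometrically on $\Gamma$ such that $\varphi$ is $G$-Galois. Assume that $\Gamma$ is not a singleton, or that $G$ is trivial. Then for every subgroup $H$ of $G$ there exists a rational function $f$ on $\Gamma$ whose stabilizer $\{g\in G : g\cdot f=f\}$ is $H$. Moreover, $f$ can be taken to be the pull-back $\operatorname{CF}(\{p\},\varepsilon)\circ\pi_H$ of a chip-firing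 move on $\Gamma/H$, for some $\varepsilon\in(0,\infty]$ and some point $p\in\Gamma/H$ that is the image of a point of $\Gamma$ not at infinity. -/

import Mathlib

open scoped ENNReal

namespace Trop

universe u v w

/-- An extended-real-valued distance. It is kept apart from the topology: at a point at infinity
of a tropical curve, the topology is not the one of the distance. -/
class TropDist (Γ : Type u) where
  /-- the distance between two points -/
  tdist : Γ → Γ → ℝ≥0∞

/-- The distance `|s - t|` of two parameters in `[0, ∞]`, with `|∞ - ∞| = 0` and
`|∞ - t| = ∞` for finite `t` (subtraction in `ℝ≥0∞` is truncated). -/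
noncomputable def gap (s t : ℝ≥0∞) : ℝ≥0∞ := (s - t) + (t - s)

/-- A finite multigraph with lengths drawn in the space `Γ`: finitely many vertices, and finitely
many edges `e`, each parametrised by the interval `[0, len e]` (a compact interval in `[0, ∞]`,
where `[0, ∞]` carries its usual topology, the one-point compactification of `[0, ∞)`).
The values of `param e` outside `[0, len e]` are irrelevant. -/
structure PreModel (Γ : Type u) [TopologicalSpace Γ] where
  /-- the vertices -/
  V : Finset Γ
  /-- the edges -/
  E : Type
  /-- there are finitely many edges -/
  [fintypeE : Fintype E]
  /-- the length function -/
  len : E → ℝ≥0∞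
  /-- the identification of an edge with `[0, len e]` -/
  param : E → ℝ≥0∞ → Γ
  len_pos : ∀ e, 0 < len e
  continuousOn_param : ∀ e, ContinuousOn (param e) (Set.Iic (len e))
  param_zero_mem : ∀ e, param e 0 ∈ V
  param_len_mem : ∀ e, param e (len e) ∈ V
  /-- the relative interiors of the edges contain no vertex -/
  param_notMem : ∀ e t, 0 < t → t < len e → param e t ∉ V
  /-- the relative interiors of the edges are embedded and pairwise disjoint -/
  param_inj : ∀ e e' t t', 0 < t → t < len e → 0 < t' → t' < len e' →
    param e t = param e' t' → e = e' ∧ t = t'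
  /-- the vertices and the edges cover the space -/
  cover : ∀ x, x ∈ V ∨ ∃ e t, 0 < t ∧ t < len e ∧ param e t = x
  /-- an edge of infinite length is a leaf edge whose leaf end is the point `∞`:
  no other end of an edge is attached there -/
  leaf : ∀ e, len e = ⊤ →
    (∀ e', param e' 0 ≠ param e ⊤) ∧ ∀ e', param e' (len e') = param e ⊤ → e' = e

attribute [instance] PreModel.fintypeE

namespace PreModel

variable {Γ : Type u} [TopologicalSpace Γ]

/-- The closed edge `e` as a subset of `Γ`. -/
def edge (M : PreModel Γ) (e : M.E) : Set Γ := M.param e '' Set.Iic (M.len e)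

/-- `M.Path x y L`: some polygonal path from `x` to `y`, each step of which runs inside one edge,
has total length `L`. -/
inductive Path (M : PreModel Γ) : Γ → Γ → ℝ≥0∞ → Prop
  | nil (x : Γ) : Path M x x 0
  | cons (e : M.E) (s t : ℝ≥0∞) (y : Γ) (L : ℝ≥0∞) (hs : s ≤ M.len e) (ht : t ≤ M.len e)
      (p : Path M (M.param e t) y L) : Path M (M.param e s) y (gap s t + L)

/-- The path distance of the graph with lengths `M`. -/
noncomputable def pathDist (M : PreModel Γ) (x y : Γ) : ℝ≥0∞ := sInf {L | M.Path x y L}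

/-- There are no loops. -/
def Loopless (M : PreModel Γ) : Prop := ∀ e, M.param e 0 ≠ M.param e (M.len e)

end PreModel

/-- A model for `Γ`: a graph with lengths whose underlying space is `Γ` and whose path distance
is the distance of `Γ`. -/
structure Model (Γ : Type u) [TopologicalSpace Γ] [TropDist Γ] extends PreModel Γ where
  tdist_eq : ∀ x y : Γ, TropDist.tdist x y = toPreModel.pathDist x y

/-- A tropical curve: a space with a distance that has a model. As a model is a continuous image
of a finite disjoint union of points and compact intervals, the Hausdorff property says that `Γ`
carries the quotient topology; connectedness says that the graph is connected and nonempty. -/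
class TropicalCurve (Γ : Type u) [TopologicalSpace Γ] [TropDist Γ] : Prop extends
    T2Space Γ, ConnectedSpace Γ where
  nonempty_model : Nonempty (Model Γ)

section curve

variable (Γ : Type u) [TopologicalSpace Γ] [TropDist Γ]

/-- The set of points at infinity. -/
def pointsAtInfinity : Set Γ :=
  {x | ∃ (M : Model Γ) (e : M.E), M.len e = ⊤ ∧ M.param e ⊤ = x}

/-- The rational functions on `Γ`: the constant function `-∞`, and the continuous functions
with values in `[-∞, ∞]`, finite off the points at infinity, that on each edge of a model are
piecewise affine with integer slopes and finitely many pieces, the pieces being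
cut out by the finite set `S` of break points. -/
def Rat : Set (Γ → EReal) :=
  {f | (∀ x, f x = ⊥) ∨
    (Continuous f ∧ (∀ x ∉ pointsAtInfinity Γ, f x ≠ ⊤ ∧ f x ≠ ⊥) ∧
      ∃ M : Model Γ, ∀ e : M.E, ∃ S : Finset ℝ, ∀ a b : ℝ, 0 ≤ a → a ≤ b →
        ENNReal.ofReal b ≤ M.len e → (∀ s ∈ S, s ≤ a ∨ b ≤ s) →
        ∃ (m : ℤ) (c : ℝ), ∀ t ∈ Set.Icc a b,
          f (M.param e (ENNReal.ofReal t)) = ((m * t + c : ℝ) : EReal))}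

end curve

/-- The chip-firing move `CF(S, l)(x) = - min (l, dist (x, S))`. -/
noncomputable def chipFiring {Γ : Type u} [TropDist Γ] (S : Set Γ) (l : ℝ≥0∞) (x : Γ) : EReal :=
  -((min l (⨅ y ∈ S, TropDist.tdist x y) : ℝ≥0∞) : EReal)

section morphism

variable {Γ : Type u} {Γ' : Type v} [TopologicalSpace Γ] [TropDist Γ] [TopologicalSpace Γ']
  [TropDist Γ']

open scoped Classical in
/-- Loopless models for source and target that exhibit `φ` as a finite harmonic morphism. -/
structure HarmonicData (φ : Γ → Γ') where
  /-- the model of the source -/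
  M : Model Γ
  /-- the model of the target -/
  M' : Model Γ'
  loopless : M.Loopless
  loopless' : M'.Loopless
  /-- vertices go to vertices -/
  map_vertex : ∀ v ∈ M.V, φ v ∈ M'.V
  /-- the edge to which an edge goes -/
  edgeMap : M.E → M'.E
  image_edge : ∀ e, φ '' M.edge e = M'.edge (edgeMap e)
  /-- the degree of `φ` on an edge -/
  edgeDeg : M.E → ℕ
  edgeDeg_pos : ∀ e, 0 < edgeDeg e
  tdist_map : ∀ e, ∀ x ∈ M.edge e, ∀ y ∈ M.edge e,
    TropDist.tdist (φ x) (φ y) = edgeDeg e * TropDist.tdist x y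
  /-- the degree of `φ` at a vertex -/
  vertexDeg : Γ → ℕ
  /-- the sum of the degrees on the edges at `v` over an edge `e'` at `φ v` does not
  depend on `e'` -/
  harmonic : ∀ v ∈ M.V, ∀ e' : M'.E, φ v ∈ M'.edge e' →
    ∑ e with edgeMap e = e' ∧ v ∈ M.edge e, edgeDeg e = vertexDeg v

open scoped Classical in
/-- `φ` is a finite harmonic morphism of degree `d`. (A map between singletons has every degree,
as the degree at its vertex is not constrained.) -/
def IsFiniteHarmonicOfDegree (φ : Γ → Γ') (d : ℕ) : Prop :=
  Continuous φ ∧ ∃ D : HarmonicData φ, ∀ v' ∈ D.M'.V, ∑ v ∈ D.M.V with φ v = v', D.vertexDeg v = d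

end morphism

section action

variable (G : Type w) [Group G] {Γ : Type u} [TopologicalSpace Γ] [TropDist Γ] [MulAction G Γ]

variable (Γ) in
/-- `G` acts isometrically on `Γ`: it acts continuously, and by isometries off the points at
infinity. -/
def IsometricAction : Prop :=
  (∀ g : G, Continuous fun x : Γ => g • x) ∧
    ∀ (g : G) (x y : Γ), x ∉ pointsAtInfinity Γ → y ∉ pointsAtInfinity Γ →
      TropDist.tdist (g • x) (g • y) = TropDist.tdist x y

/-- `φ` is `G`-Galois. -/
structure IsGalois {Γ' : Type v} [TopologicalSpace Γ'] [TropDist Γ'] (φ : Γ → Γ') : Prop where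
  /-- `φ` is a finite harmonic morphism of degree `|G|` -/
  degree : IsFiniteHarmonicOfDegree φ (Nat.card G)
  /-- `G` acts on every fibre ... -/
  map_smul : ∀ (g : G) (x : Γ), φ (g • x) = φ x
  /-- ... and transitively so -/
  transitive : ∀ x y : Γ, φ x = φ y → ∃ g : G, g • x = y
  /-- all but finitely many points have trivial stabilizer -/
  finite_stabilizer : {x : Γ | MulAction.stabilizer G x ≠ ⊥}.Finite

/-- The stabilizer of `f` under the induced action `(g • f) x = f (g⁻¹ • x)` on functions. -/
def functionStabilizer (f : Γ → EReal) : Subgroup G :=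
  letI : MulAction G (Γ → EReal) := arrowAction
  MulAction.stabilizer G f

variable {G}

/-- The natural surjection `π_H : Γ → Γ / H`. -/
def quotientMap (H : Subgroup G) (x : Γ) : MulAction.orbitRel.Quotient H Γ :=
  Quotient.mk (MulAction.orbitRel H Γ) x

/-- Paths in the quotient graph of `M` by `H`, in which the image of an edge `e` has length
`|H_e| * len e`, with `H_e` the group of the elements of `H` that fix `e`. -/
inductive PreModel.QuotientPath (M : PreModel Γ) (H : Subgroup G) :
    MulAction.orbitRel.Quotient H Γ → MulAction.orbitRel.Quotient H Γ → ℝ≥0∞ → Prop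
  | nil (a : MulAction.orbitRel.Quotient H Γ) : PreModel.QuotientPath M H a a 0
  | cons (e : M.E) (s t : ℝ≥0∞) (b : MulAction.orbitRel.Quotient H Γ) (L : ℝ≥0∞)
      (hs : s ≤ M.len e) (ht : t ≤ M.len e)
      (p : PreModel.QuotientPath M H (quotientMap H (M.param e t)) b L) :
      PreModel.QuotientPath M H (quotientMap H (M.param e s)) b
        (Nat.card (fixingSubgroup H (M.edge e)) * gap s t + L)

/-- The distance of the quotient tropical curve `Γ / H`, computed from the model `M` of `Γ`. -/
noncomputable abbrev PreModel.quotientDist (M : PreModel Γ) (H : Subgroup G) :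
    TropDist (MulAction.orbitRel.Quotient H Γ) where
  tdist a b := sInf {L | M.QuotientPath H a b L}

end action

end Trop

open scoped ENNReal
namespace Trop
universe u v w

/-! ### The distance on the parameter interval `[0, ∞]` -/

section gap

/-! The Galois condition enters through the finiteness of the set of points with nontrivial
stabilizer. It provides a point `y` inside an edge with a free `G`-orbit that avoids the vertices of
a fixed model. For small `ε`, put `f x = -min (ε, dist (x, H y))`. The graph of `f` consists of
tents of height `ε` with disjoint interiors, centred at the points of `H y` and lying inside edges,
so `f` is rational (`neg_min_iInf_tdist_mem_Rat`). Its maximum `0` is attained exactly on `H y`. If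
`g` fixes `f`, then `g⁻¹ y` lies in `H y`, and freeness gives `g ∈ H`.

Conversely, `H` fixes `f` because `f` is the pull-back of a chip-firing move on `Γ / H`
(`min_quotientDist`). No nontrivial element fixes an edge, so all stretching factors `|H_e|` are `1`
(`card_fixingSubgroup_edge`): paths project with the same length, and paths shorter than `ε` that
end at the image of `y` lift step by step.

A one-point curve has trivial `G` by assumption, and `f = 0` works. -/

lemma gap_self (s : ℝ≥0∞) : gap s s = 0 := by simp [gap]

lemma gap_triangle (a b c : ℝ≥0∞) : gap a c ≤ gap a b + gap b c := by
  unfold gap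
  calc (a - c) + (c - a) ≤ ((a - b) + (b - c)) + ((c - b) + (b - a)) :=
        add_le_add tsub_le_tsub_add_tsub tsub_le_tsub_add_tsub
    _ = _ := by ring

lemma eq_of_gap_eq_zero {s t : ℝ≥0∞} (h : gap s t = 0) : s = t := by
  unfold gap at h
  rw [add_eq_zero, tsub_eq_zero_iff_le, tsub_eq_zero_iff_le] at h
  exact le_antisymm h.1 h.2

lemma gap_top_left {t : ℝ≥0∞} (ht : t ≠ ⊤) : gap ⊤ t = ⊤ := by
  simp [gap, ENNReal.top_sub ht]

lemma gap_lt_top {s t : ℝ≥0∞} (hs : s ≠ ⊤) (ht : t ≠ ⊤) : gap s t < ⊤ := by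
  unfold gap
  exact ENNReal.add_lt_top.2 ⟨tsub_le_self.trans_lt hs.lt_top, tsub_le_self.trans_lt ht.lt_top⟩

lemma gap_ofReal {a b : ℝ} (ha : 0 ≤ a) (hb : 0 ≤ b) :
    gap (ENNReal.ofReal a) (ENNReal.ofReal b) = ENNReal.ofReal |a - b| := by
  unfold gap
  rw [← ENNReal.ofReal_sub _ hb, ← ENNReal.ofReal_sub _ ha]
  rcases le_total a b with h | h
  · rw [ENNReal.ofReal_of_nonpos (sub_nonpos.2 h), zero_add, abs_of_nonpos (sub_nonpos.2 h),
      neg_sub]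
  · rw [ENNReal.ofReal_of_nonpos (sub_nonpos.2 h), add_zero, abs_of_nonneg (sub_nonneg.2 h)]

/-- Finiteness of `s` matters: `gap t ⊤` jumps from `⊤` to `0` at `t = ⊤`. -/
lemma continuous_gap_left {s : ℝ≥0∞} (hs : s ≠ ⊤) : Continuous fun t => gap t s := by
  unfold gap
  exact (ENNReal.continuous_sub_right s).add (ENNReal.continuous_sub_left hs)

/-- The ball of radius `min s (l - s)` about `s` lies in the open interval from `0` to `l`. -/
lemma mem_Ioo_of_gap_lt {s t l δ : ℝ≥0∞} (h₁ : δ ≤ s) (h₂ : δ ≤ l - s) (h : gap t s < δ) :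
    0 < t ∧ t < l := by
  constructor
  · rw [pos_iff_ne_zero]
    rintro rfl
    exact absurd h (not_lt.2 (h₁.trans (by simp [gap])))
  · by_contra! hl
    exact absurd h (not_lt.2 (h₂.trans ((tsub_le_tsub_right hl s).trans (by simp [gap]))))

end gap

/-! ### Paths in a graph with lengths -/

namespace PreModel

variable {Γ : Type u} [TopologicalSpace Γ] (M : PreModel Γ)

lemma pos_and_lt_of_notMem {e : M.E} {s : ℝ≥0∞} (hs : s ≤ M.len e) (h : M.param e s ∉ M.V) :
    0 < s ∧ s < M.len e := by
  refine ⟨pos_iff_ne_zero.2 ?_, lt_of_le_of_ne hs ?_⟩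
  · rintro rfl
    exact h (M.param_zero_mem e)
  · rintro rfl
    exact h (M.param_len_mem e)

/-- A path that ends in the interior of an edge and is shorter than the distance to the ends of
that edge starts on the same edge. -/
lemma exists_param_of_path {e : M.E} {s δ : ℝ≥0∞} (h₁ : δ ≤ s) (h₂ : δ ≤ M.len e - s)
    {x : Γ} {L : ℝ≥0∞} (p : M.Path x (M.param e s) L) (hL : L < δ) :
    ∃ t, x = M.param e t ∧ gap t s ≤ L := by
  generalize hz : M.param e s = z at p
  induction p with
  | nil x => exact ⟨s, hz.symm, (gap_self s).le⟩
  | cons e' s' t' y L hs ht p ih =>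
    obtain ⟨t, hxt, hg⟩ := ih (lt_of_le_of_lt le_add_self hL) hz
    have hg' : gap t s < δ := lt_of_le_of_lt (hg.trans le_add_self) hL
    obtain ⟨ht0, htl⟩ := mem_Ioo_of_gap_lt h₁ h₂ hg'
    -- The current point is interior to `e`, hence not a vertex, hence interior to `e'` too; edges
    -- have disjoint interiors, so the step runs along `e` itself.
    obtain ⟨ht0', htl'⟩ := M.pos_and_lt_of_notMem ht (by
      rw [hxt]
      exact M.param_notMem e t ht0 htl)
    obtain ⟨rfl, rfl⟩ := M.param_inj e' e t' t ht0' htl' ht0 htl hxt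
    exact ⟨s', rfl, (gap_triangle s' t' s).trans (by gcongr)⟩

lemma infinite_edge (e : M.E) : (M.param e '' Set.Ioo 0 (M.len e)).Infinite := by
  refine (Set.infinite_image_iff ?_).2 (Set.Ioo_infinite (M.len_pos e))
  intro s hs t ht h
  exact (M.param_inj e e s t hs.1 hs.2 ht.1 ht.2 h).2

/-- No path of finite length leaves the infinite end of an edge. -/
lemma eq_or_eq_top_of_path {e : M.E} (he : M.len e = ⊤) {x y : Γ} {L : ℝ≥0∞} (p : M.Path x y L)
    (hx : x = M.param e ⊤) : y = M.param e ⊤ ∨ L = ⊤ := by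
  induction p with
  | nil x => exact Or.inl hx
  | cons e' s t y L hs ht p ih =>
    have hV : M.param e ⊤ ∈ M.V := he ▸ M.param_len_mem e
    -- The infinite end is a vertex, so it can only be an end of `e'`; the leaf condition excludes
    -- the end `0` and then forces `e' = e`.
    have hs' : s = M.len e' := by
      by_contra hne
      rcases eq_or_ne s 0 with rfl | h0
      · exact (M.leaf e he).1 e' hx
      · exact M.param_notMem e' s (pos_iff_ne_zero.2 h0) (lt_of_le_of_ne hs hne) (hx ▸ hV)
    subst hs'
    obtain rfl := (M.leaf e he).2 e' hx
    rcases eq_or_ne t ⊤ with rfl | ht'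
    · exact (ih rfl).imp id fun h => by simp [h]
    · exact Or.inr (by rw [he, gap_top_left ht', top_add])

end PreModel

/-! ### The path distance near an interior point of an edge -/

namespace Model

variable {Γ : Type u} [TopologicalSpace Γ] [TropDist Γ] (M : Model Γ)

lemma tdist_le_of_path {x y : Γ} {L : ℝ≥0∞} (p : M.Path x y L) : TropDist.tdist x y ≤ L := by
  rw [M.tdist_eq]
  exact sInf_le p

include M in
lemma tdist_self (x : Γ) : TropDist.tdist x x = 0 :=
  le_antisymm (M.tdist_le_of_path (.nil x)) zero_le

lemma tdist_param_le {e : M.E} {s t : ℝ≥0∞} (hs : s ≤ M.len e) (ht : t ≤ M.len e) :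
    TropDist.tdist (M.param e s) (M.param e t) ≤ gap s t := by
  simpa using M.tdist_le_of_path (.cons e s t _ 0 hs ht (.nil _))

lemma tdist_param_le_add {e : M.E} {s t : ℝ≥0∞} (hs : s ≤ M.len e) (ht : t ≤ M.len e) (z : Γ) :
    TropDist.tdist (M.param e s) z ≤ gap s t + TropDist.tdist (M.param e t) z := by
  rw [M.tdist_eq (M.param e t), PreModel.pathDist, ENNReal.add_sInf]
  exact le_iInf₂ fun L hL => M.tdist_le_of_path (.cons e s t _ L hs ht hL)

/-- The points near an interior point of an edge lie on that edge, and their distance is the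
one measured along the edge. -/
lemma exists_param_of_tdist_lt {e : M.E} {s δ : ℝ≥0∞} (h₁ : δ ≤ s) (h₂ : δ ≤ M.len e - s)
    {x : Γ} (hx : TropDist.tdist x (M.param e s) < δ) :
    ∃ t, 0 < t ∧ t < M.len e ∧ x = M.param e t ∧ gap t s ≤ TropDist.tdist x (M.param e s) := by
  rw [M.tdist_eq] at hx ⊢
  obtain ⟨L, hL, hLδ⟩ := sInf_lt_iff.1 hx
  obtain ⟨t, rfl, hg⟩ := M.exists_param_of_path h₁ h₂ hL hLδ
  obtain ⟨ht0, htl⟩ := mem_Ioo_of_gap_lt h₁ h₂ (hg.trans_lt hLδ)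
  refine ⟨t, ht0, htl, rfl, le_sInf fun L' hL' => ?_⟩
  -- Another path shorter than `δ` leads to the same parameter `t` by injectivity; a path of length
  -- at least `δ` is already longer than `gap t s`.
  rcases lt_or_ge L' δ with h | h
  · obtain ⟨t', ht', hg'⟩ := M.exists_param_of_path h₁ h₂ hL' h
    obtain ⟨ht0', htl'⟩ := mem_Ioo_of_gap_lt h₁ h₂ (hg'.trans_lt h)
    rwa [(M.param_inj e e t t' ht0 htl ht0' htl' ht').2]
  · exact (hg.trans hLδ.le).trans h

lemma exists_radius {z : Γ} (hz : z ∉ M.V) : ∃ (e : M.E) (s δ : ℝ≥0∞), M.param e s = z ∧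
    s < M.len e ∧ 0 < δ ∧ δ ≤ s ∧ δ ≤ M.len e - s := by
  obtain ⟨e, s, h0, hl, rfl⟩ := (M.cover z).resolve_left hz
  exact ⟨e, s, min s (M.len e - s), rfl, hl, lt_min h0 (tsub_pos_of_lt hl), min_le_left _ _,
    min_le_right _ _⟩

lemma tdist_pos {x z : Γ} (hz : z ∉ M.V) (h : x ≠ z) : 0 < TropDist.tdist x z := by
  obtain ⟨e, s, δ, rfl, -, hδ, h₁, h₂⟩ := M.exists_radius hz
  rw [pos_iff_ne_zero]
  intro h0
  obtain ⟨t, -, -, rfl, hg⟩ := M.exists_param_of_tdist_lt h₁ h₂ (h0 ▸ hδ)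
  rw [h0, nonpos_iff_eq_zero] at hg
  exact h (congrArg _ (eq_of_gap_eq_zero hg))

/-- Along an edge, the distance to a point in the interior of an edge, truncated by the distance
of that point to the vertices, is measured along the edge. -/
lemma min_tdist_param [DecidableEq M.E] {e e' : M.E} {s t ε : ℝ≥0∞} (ht : t ≤ M.len e)
    (hs : s ≤ M.len e') (h₁ : ε ≤ s) (h₂ : ε ≤ M.len e' - s) :
    min ε (TropDist.tdist (M.param e t) (M.param e' s)) =
      if e' = e then min ε (gap t s) else ε := by
  rcases lt_or_ge (TropDist.tdist (M.param e t) (M.param e' s)) ε with h | h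
  · obtain ⟨t', h0, hl, hx, hg⟩ := M.exists_param_of_tdist_lt h₁ h₂ h
    obtain ⟨ht0, htl⟩ := M.pos_and_lt_of_notMem ht (by
      rw [hx]
      exact M.param_notMem e' t' h0 hl)
    obtain ⟨rfl, rfl⟩ := M.param_inj e e' t t' ht0 htl h0 hl hx
    rw [if_pos rfl]
    exact le_antisymm (min_le_min_left _ (M.tdist_param_le ht hs)) (min_le_min_left _ hg)
  · rw [min_eq_left h]
    split_ifs with he
    · subst he
      exact (min_eq_left (h.trans (M.tdist_param_le ht hs))).symm
    · rfl

end Model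

/-! ### Points at infinity -/

section infinity

variable {Γ : Type u} [TopologicalSpace Γ] [TropDist Γ]

lemma tdist_eq_top_of_mem_pointsAtInfinity {x y : Γ} (hx : x ∈ pointsAtInfinity Γ) (h : y ≠ x) :
    TropDist.tdist x y = ⊤ := by
  obtain ⟨M, e, he, rfl⟩ := hx
  rw [M.tdist_eq]
  exact sInf_eq_top.2 fun L hL => (M.eq_or_eq_top_of_path he hL rfl).resolve_left h

/-- A point at infinity, seen in whichever model, is infinitely far from all other points, whereas
an interior point of an edge of `M` has others at finite distance. -/
lemma pointsAtInfinity_subset (M : Model Γ) : pointsAtInfinity Γ ⊆ M.V := by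
  intro x hx
  by_contra hV
  obtain ⟨e, t, h0, hl, rfl⟩ := (M.cover x).resolve_left hV
  obtain ⟨s, hs0, hst⟩ := exists_between h0
  have hsl := hst.trans hl
  have hne : M.param e s ≠ M.param e t := fun h =>
    hst.ne (M.param_inj e e s t hs0 hsl h0 hl h).2
  have h := M.tdist_param_le hl.le hsl.le
  rw [tdist_eq_top_of_mem_pointsAtInfinity hx hne, top_le_iff] at h
  exact (gap_lt_top (ne_top_of_lt hl) (ne_top_of_lt hsl)).ne h

end infinity

/-! ### Truncated distances as rational functions -/

section rat

variable {Γ : Type u} [TopologicalSpace Γ]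

/-- A tropical curve carries the quotient topology from the edges of a model. -/
lemma continuous_of_continuousOn_edges [T2Space Γ] (M : PreModel Γ) {X : Type*}
    [TopologicalSpace X] {f : Γ → X}
    (hf : ∀ e, ContinuousOn (fun t => f (M.param e t)) (Set.Iic (M.len e))) : Continuous f := by
  rw [continuous_iff_isClosed]
  intro C hC
  -- A finite set together with finitely many images of compact sets, hence closed in a Hausdorff
  -- space.
  have h : f ⁻¹' C = ((M.V : Set Γ) ∩ f ⁻¹' C) ∪
      ⋃ e, M.param e '' (Set.Iic (M.len e) ∩ (fun t => f (M.param e t)) ⁻¹' C) := by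
    ext x
    simp only [Set.mem_preimage, Set.mem_union, Set.mem_inter_iff, Set.mem_iUnion, Set.mem_image,
      Set.mem_Iic, Finset.mem_coe]
    constructor
    · intro hx
      rcases M.cover x with hV | ⟨e, t, -, hl, rfl⟩
      · exact Or.inl ⟨hV, hx⟩
      · exact Or.inr ⟨e, t, ⟨hl.le, hx⟩, rfl⟩
    · rintro (⟨-, hx⟩ | ⟨e, t, ⟨-, hx⟩, rfl⟩) <;> exact hx
  rw [h]
  refine (M.V.finite_toSet.inter_of_left _).isClosed.union (isClosed_iUnion_of_finite fun e => ?_)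
  have hcl := (hf e).preimage_isClosed_of_isClosed isClosed_Iic hC
  exact (hcl.isCompact.image_of_continuousOn
    ((M.continuousOn_param e).mono Set.inter_subset_left)).isClosed

variable [TropDist Γ]

/-- The truncated distance to finitely many points in the interiors of edges, with disjoint balls
as neighbourhoods, is a rational function. -/
lemma neg_min_iInf_tdist_mem_Rat [T2Space Γ] (M : Model Γ) {ι : Type*} [Finite ι] [Nonempty ι]
    {ε : ℝ} (hε : 0 < ε) {e : ι → M.E} {s : ι → ℝ≥0∞} (hs : ∀ i, s i < M.len (e i))
    (h₁ : ∀ i, ENNReal.ofReal ε ≤ s i) (h₂ : ∀ i, ENNReal.ofReal ε ≤ M.len (e i) - s i)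
    (hsep : ∀ i j, i ≠ j → ENNReal.ofReal (2 * ε) ≤
      TropDist.tdist (M.param (e i) (s i)) (M.param (e j) (s j))) :
    (fun x => -((min (ENNReal.ofReal ε)
      (⨅ i, TropDist.tdist x (M.param (e i) (s i))) : ℝ≥0∞) : EReal)) ∈ Rat Γ := by
  classical
  cases nonempty_fintype ι
  have key : ∀ a t, t ≤ M.len a →
      min (ENNReal.ofReal ε) (⨅ i, TropDist.tdist (M.param a t) (M.param (e i) (s i))) =
        ⨅ i, if e i = a then min (ENNReal.ofReal ε) (gap t (s i)) else ENNReal.ofReal ε := by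
    intro a t ht
    rw [inf_iInf]
    exact iInf_congr fun i => M.min_tdist_param ht (hs i).le (h₁ i) (h₂ i)
  refine Or.inr ⟨?_, fun x _ => ?_, M, fun a => ?_⟩
  · refine continuous_neg.comp (continuous_coe_ennreal_ereal.comp
      (continuous_of_continuousOn_edges M.toPreModel fun a => ?_))
    refine ContinuousOn.congr (f := fun t => ⨅ i,
      if e i = a then min (ENNReal.ofReal ε) (gap t (s i)) else ENNReal.ofReal ε) ?_
      fun t ht => key a t ht
    simp only [← Finset.inf_univ_eq_iInf]
    refine (Continuous.finset_inf_apply fun i _ => ?_).continuousOn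
    split_ifs
    · exact continuous_const.min (continuous_gap_left (ne_top_of_lt (hs i)))
    · exact continuous_const
  · have hlt : min (ENNReal.ofReal ε) (⨅ i, TropDist.tdist x (M.param (e i) (s i))) ≠ ⊤ :=
      ((min_le_left _ _).trans_lt ENNReal.ofReal_lt_top).ne
    lift min (ENNReal.ofReal ε) (⨅ i, TropDist.tdist x (M.param (e i) (s i))) to NNReal
      using hlt with r
    exact ⟨EReal.coe_ne_top (-r), EReal.coe_ne_bot (-r)⟩
  · have hgap : ∀ i (t : ℝ), 0 ≤ t → gap (ENNReal.ofReal t) (s i) =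
        ENNReal.ofReal |t - (s i).toReal| := by
      intro i t ht
      conv_lhs => rw [← ENNReal.ofReal_toReal (ne_top_of_lt (hs i))]
      exact gap_ofReal ht ENNReal.toReal_nonneg
    have hsep' : ∀ i j, i ≠ j → e i = a → e j = a →
        2 * ε ≤ |(s i).toReal - (s j).toReal| := by
      intro i j hij hi hj
      have h := hsep i j hij
      have hj' := (hs j).le
      have hi' := (hs i).le
      rw [hj] at h hj'
      rw [hi] at h hi'
      have h' := h.trans (M.tdist_param_le hi' hj')
      rw [← ENNReal.ofReal_toReal (ne_top_of_lt (hs i)), hgap j _ ENNReal.toReal_nonneg] at h'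
      exact (ENNReal.ofReal_le_ofReal_iff (abs_nonneg _)).1 h'
    -- The slope can change only at the apex of a tent and at its two feet.
    refine ⟨Finset.univ.image (fun i => (s i).toReal) ∪
      (Finset.univ.image (fun i => (s i).toReal - ε) ∪
        Finset.univ.image fun i => (s i).toReal + ε), fun b c hb hbc hc hS => ?_⟩
    have hS₀ : ∀ i, (s i).toReal ≤ b ∨ c ≤ (s i).toReal := fun i => hS _ (by simp)
    have hS₁ : ∀ i, (s i).toReal - ε ≤ b ∨ c ≤ (s i).toReal - ε := fun i => hS _ (by simp)
    have hS₂ : ∀ i, (s i).toReal + ε ≤ b ∨ c ≤ (s i).toReal + ε := fun i => hS _ (by simp)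
    have htl : ∀ t ∈ Set.Icc b c, ENNReal.ofReal t ≤ M.len a := fun t ht =>
      (ENNReal.ofReal_le_ofReal ht.2).trans hc
    -- With no break point inside, a piece that meets the interior of a tent lies on one side of
    -- that tent, with slope `±1`; on every other piece the function is `-ε`.
    by_cases hex : ∃ i, e i = a ∧ ∃ t ∈ Set.Icc b c, |t - (s i).toReal| < ε
    · obtain ⟨i, hi, t₀, ht₀, hlt⟩ := hex
      rw [abs_lt] at hlt
      have hb' : (s i).toReal - ε ≤ b := (hS₁ i).resolve_right fun h => by
        linarith [ht₀.2, hlt.1]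
      have hc' : c ≤ (s i).toReal + ε := (hS₂ i).resolve_left fun h => by
        linarith [ht₀.1, hlt.2]
      have hval : ∀ t ∈ Set.Icc b c, (min (ENNReal.ofReal ε)
          (⨅ i, TropDist.tdist (M.param a (ENNReal.ofReal t)) (M.param (e i) (s i)))) =
            ENNReal.ofReal |t - (s i).toReal| := by
        intro t ht
        have hle : |t - (s i).toReal| ≤ ε := abs_le.2 ⟨by linarith [ht.1], by linarith [ht.2]⟩
        have ht0 : 0 ≤ t := hb.trans ht.1
        rw [key a _ (htl t ht)]
        refine le_antisymm (iInf_le_of_le i ?_) (le_iInf fun j => ?_)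
        · rw [if_pos hi, hgap i t ht0]
          exact min_le_right _ _
        · split_ifs with hj
          · refine le_min (ENNReal.ofReal_le_ofReal hle) ?_
            rw [hgap j t ht0]
            refine ENNReal.ofReal_le_ofReal ?_
            rcases eq_or_ne i j with rfl | hij
            · exact le_rfl
            -- Centres are at least `2ε` apart and `t` is within `ε` of centre `i`, so centre `j` is
            -- no nearer.
            · have := hsep' i j hij hi hj
              have := abs_sub_le (s i).toReal t (s j).toReal
              rw [abs_sub_comm (s i).toReal t] at this
              linarith
          · exact ENNReal.ofReal_le_ofReal hle
      rcases hS₀ i with h | h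
      · refine ⟨-1, (s i).toReal, fun t ht => ?_⟩
        simp only [hval t ht]
        rw [EReal.coe_ennreal_ofReal, max_eq_left (abs_nonneg _),
          abs_of_nonneg (by linarith [ht.1]), ← EReal.coe_neg]
        congr 1
        push_cast
        ring
      · refine ⟨1, -(s i).toReal, fun t ht => ?_⟩
        simp only [hval t ht]
        rw [EReal.coe_ennreal_ofReal, max_eq_left (abs_nonneg _),
          abs_of_nonpos (by linarith [ht.2]), ← EReal.coe_neg]
        congr 1
        push_cast
        ring
    · push Not at hex
      refine ⟨0, -ε, fun t ht => ?_⟩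
      have hval : (min (ENNReal.ofReal ε)
          (⨅ i, TropDist.tdist (M.param a (ENNReal.ofReal t)) (M.param (e i) (s i)))) =
            ENNReal.ofReal ε := by
        refine le_antisymm (min_le_left _ _) ?_
        rw [key a _ (htl t ht)]
        refine le_iInf fun j => ?_
        split_ifs with hj
        · refine le_min le_rfl ?_
          rw [hgap j t (hb.trans ht.1)]
          exact ENNReal.ofReal_le_ofReal (hex j hj t ht)
        · exact le_rfl
      simp only [hval]
      rw [EReal.coe_ennreal_ofReal, max_eq_left hε.le, ← EReal.coe_neg]
      simp

lemma zero_mem_Rat (M : Model Γ) : (fun _ => 0) ∈ Rat Γ :=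
  Or.inr ⟨continuous_const, fun _ _ => ⟨EReal.zero_ne_top, EReal.zero_ne_bot⟩, M, fun _ =>
    ⟨∅, fun _ _ _ _ _ _ => ⟨0, 0, fun _ _ => by simp⟩⟩⟩

end rat

/-! ### The quotient by `H` and its distance -/

section quotient

variable {G : Type w} [Group G] {Γ : Type u} [MulAction G Γ]

lemma quotientMap_smul (H : Subgroup G) (h : H) (x : Γ) :
    quotientMap H (h • x) = quotientMap H x :=
  Quotient.sound ⟨h, rfl⟩

lemma exists_smul_eq_of_quotientMap_eq {H : Subgroup G} {x y : Γ}
    (h : quotientMap H x = quotientMap H y) : ∃ k : H, k • y = x :=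
  Quotient.exact h

lemma mem_functionStabilizer {f : Γ → EReal} {g : G} :
    g ∈ functionStabilizer G f ↔ ∀ x, f (g⁻¹ • x) = f x :=
  funext_iff

variable [TopologicalSpace Γ]

/-- If almost all points have trivial stabilizer, no nontrivial element fixes an edge. -/
lemma card_fixingSubgroup_edge (hfin : {x : Γ | MulAction.stabilizer G x ≠ ⊥}.Finite)
    (M : PreModel Γ) (H : Subgroup G) (e : M.E) :
    Nat.card (fixingSubgroup H (M.edge e)) = 1 := by
  obtain ⟨_, ⟨t, ht, rfl⟩, hx⟩ := (M.infinite_edge e).exists_notMem_finite hfin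
  rw [Set.mem_ofPred_eq, not_not] at hx
  rw [Subgroup.card_eq_one, Subgroup.eq_bot_iff_forall]
  intro h hh
  have hfix : h • M.param e t = M.param e t :=
    (mem_fixingSubgroup_iff H).1 hh _ ⟨t, ht.2.le, rfl⟩
  have : (h : G) ∈ MulAction.stabilizer G (M.param e t) := hfix
  rw [hx, Subgroup.mem_bot] at this
  exact Subtype.ext this

lemma quotientPath_of_path {M : PreModel Γ} {H : Subgroup G}
    (hcard : ∀ e, Nat.card (fixingSubgroup H (M.edge e)) = 1) {x y : Γ} {L : ℝ≥0∞}
    (p : M.Path x y L) : M.QuotientPath H (quotientMap H x) (quotientMap H y) L := by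
  induction p with
  | nil x => exact .nil _
  | cons e s t y L hs ht p ih => simpa [hcard e] using ih.cons e s t _ L hs ht

variable [TropDist Γ]

/-- A short path in the quotient lifts: every point over its start is at most as far from the
orbit over its end. -/
lemma exists_tdist_le_of_quotientPath (hG : IsometricAction G Γ) (M : Model Γ) {H : Subgroup G}
    (hcard : ∀ e, Nat.card (fixingSubgroup H (M.edge e)) = 1) {y : Γ} {ε : ℝ≥0∞}
    (hfar : ∀ (g k : G) (x : Γ), TropDist.tdist x (g • y) < ε → k • x ∉ pointsAtInfinity Γ)
    (hy : ∀ g : G, g • y ∉ pointsAtInfinity Γ)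
    {a : MulAction.orbitRel.Quotient H Γ} {L : ℝ≥0∞}
    (p : M.QuotientPath H a (quotientMap H y) L) (hL : L < ε) {x : Γ} (hx : quotientMap H x = a) :
    ∃ h : H, TropDist.tdist x (h • y) ≤ L := by
  generalize hb : quotientMap H y = b at p
  induction p generalizing x with
  | nil a =>
    obtain ⟨k, rfl⟩ := exists_smul_eq_of_quotientMap_eq (hx.trans hb.symm)
    exact ⟨k, (M.tdist_self _).le⟩
  | cons e s t b L hs ht p ih =>
    rw [hcard e, Nat.cast_one, one_mul] at hL ⊢
    obtain ⟨h, hh⟩ := ih (lt_of_le_of_lt le_add_self hL) rfl hb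
    obtain ⟨k, rfl⟩ := exists_smul_eq_of_quotientMap_eq hx
    have hle : TropDist.tdist (M.param e s) (h • y) ≤ gap s t + L :=
      (M.tdist_param_le_add hs ht _).trans (by gcongr)
    -- The lift starts at a translate of `M.param e s`. Elements of `G` are isometries only off the
    -- points at infinity; closeness to the orbit of `y` keeps this point away from them.
    have hfar' := fun k : G => hfar h k (M.param e s) (hle.trans_lt hL)
    refine ⟨k * h, ?_⟩
    rw [mul_smul]
    exact (hG.2 k _ _ (by simpa using hfar' 1) (hy h)).trans_le hle

/-- Projecting paths gives `≤`, lifting them gives `≥`. Only paths shorter than `ε` are lifted,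
which is why both sides are truncated. -/
lemma min_quotientDist (hG : IsometricAction G Γ) (M : Model Γ) {H : Subgroup G}
    (hcard : ∀ e, Nat.card (fixingSubgroup H (M.edge e)) = 1) {y : Γ} {ε : ℝ≥0∞}
    (hfar : ∀ (g k : G) (x : Γ), TropDist.tdist x (g • y) < ε → k • x ∉ pointsAtInfinity Γ)
    (hy : ∀ g : G, g • y ∉ pointsAtInfinity Γ) (x : Γ) :
    min ε (sInf {L | M.QuotientPath H (quotientMap H x) (quotientMap H y) L}) =
      min ε (⨅ h : H, TropDist.tdist x (h • y)) := by
  refine le_antisymm (min_le_min_left _ (le_iInf fun h => ?_)) (le_min (min_le_left _ _) ?_)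
  · rw [M.tdist_eq]
    refine le_sInf fun L hL => sInf_le ?_
    rw [Set.mem_ofPred_eq, ← quotientMap_smul H h y]
    exact quotientPath_of_path hcard hL
  · refine le_sInf fun L hL => ?_
    rcases lt_or_ge L ε with h | h
    · obtain ⟨k, hk⟩ := exists_tdist_le_of_quotientPath hG M hcard hfar hy hL h rfl
      exact (min_le_right _ _).trans ((iInf_le _ k).trans hk)
    · exact (min_le_left _ _).trans h

end quotient

lemma exists_pos_le_of_finite {ι : Type*} [Finite ι] {d : ι → ℝ≥0∞} (hd : ∀ i, 0 < d i) :
    ∃ δ, 0 < δ ∧ ∀ i, δ ≤ d i := by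
  cases nonempty_fintype ι
  exact ⟨Finset.univ.inf d, (Finset.lt_inf_iff ENNReal.zero_lt_top).2 fun i _ => hd i,
    fun i => Finset.inf_le (Finset.mem_univ i)⟩

/-! ### Choice of the point and of the radius -/

section main

variable {G : Type w} [Group G] {Γ : Type u} [TopologicalSpace Γ] [TropDist Γ] [MulAction G Γ]

/-- Without edges the space would be finite and Hausdorff, hence discrete, and connectedness would
leave a single point. -/
lemma exists_edge [TropicalCurve Γ] [Nontrivial Γ] (M : PreModel Γ) : Nonempty M.E := by
  by_contra hE
  rw [not_nonempty_iff] at hE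
  have hV : ∀ x, x ∈ M.V := fun x => (M.cover x).resolve_right fun ⟨e, _⟩ => hE.elim e
  have : Finite Γ := Set.finite_univ_iff.1 (M.V.finite_toSet.subset fun x _ => hV x)
  exact not_subsingleton Γ (PreconnectedSpace.trivial_of_discrete (X := Γ))

lemma exists_rat_of_nontrivial [TropicalCurve Γ] [Nontrivial Γ] [Finite G]
    (hG : IsometricAction G Γ) (hfin : {x : Γ | MulAction.stabilizer G x ≠ ⊥}.Finite)
    (H : Subgroup G) :
    ∃ f ∈ Rat Γ, functionStabilizer G f = H ∧
      ∃ y ∉ pointsAtInfinity Γ, ∃ ε : ℝ≥0∞, 0 < ε ∧ ∀ M : Model Γ,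
        f = @chipFiring _ (M.quotientDist H) {quotientMap H y} ε ∘ quotientMap H := by
  obtain ⟨M⟩ := TropicalCurve.nonempty_model (Γ := Γ)
  obtain ⟨e₀⟩ := exists_edge M.toPreModel
  -- The `G`-saturation of the vertex set: avoiding it keeps the whole orbit of `y` inside edges. It
  -- also contains all translates of points at infinity.
  set F : Set Γ := ⋃ g : G, (g • ·) '' (M.V : Set Γ) with hF
  have hFfin : F.Finite := Set.finite_iUnion fun g => M.V.finite_toSet.image _
  have hFV : ∀ x ∈ M.V, x ∈ F := fun x hx => Set.mem_iUnion.2 ⟨1, x, hx, one_smul _ _⟩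
  have hFG : ∀ (g : G) (x : Γ), g • x ∈ F → x ∈ F := by
    intro g x hx
    obtain ⟨k, v, hv, hk⟩ := Set.mem_iUnion.1 hx
    exact Set.mem_iUnion.2 ⟨g⁻¹ * k, v, hv, by
      simp only at hk ⊢
      rw [mul_smul, hk, inv_smul_smul]⟩
  obtain ⟨y, -, hyF⟩ := (M.infinite_edge e₀).exists_notMem_finite (hFfin.union hfin)
  obtain ⟨hyF, hys⟩ : y ∉ F ∧ MulAction.stabilizer G y = ⊥ := by
    simpa [not_or] using hyF
  have hfree : ∀ g k : G, g • y = k • y → g = k := by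
    intro g k h
    have : k⁻¹ * g ∈ MulAction.stabilizer G y := by
      rw [MulAction.mem_stabilizer_iff, mul_smul, h, inv_smul_smul]
    rw [hys, Subgroup.mem_bot, inv_mul_eq_one] at this
    exact this.symm
  have hyV : ∀ g : G, g • y ∉ M.V := fun g h => hyF (hFG g y (hFV _ h))
  have hinf : ∀ x ∈ pointsAtInfinity Γ, x ∈ F := fun x hx => hFV x (pointsAtInfinity_subset M hx)
  have hy : ∀ g : G, g • y ∉ pointsAtInfinity Γ := fun g h => hyF (hFG g y (hinf _ h))
  choose e s δ hes hs hδ hδ₁ hδ₂ using fun g : G => M.exists_radius (hyV g)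
  have : Finite F := hFfin
  -- The three bounds keep the tents inside their edges, the `ε`-balls about the orbit away from
  -- `F`, and the orbit points apart.
  obtain ⟨ε₁, hε₁, hε₁'⟩ := exists_pos_le_of_finite hδ
  obtain ⟨ε₂, hε₂, hε₂'⟩ := exists_pos_le_of_finite
    (d := fun p : G × F => TropDist.tdist (p.2 : Γ) (p.1 • y)) fun p =>
      M.tdist_pos (hyV p.1) fun h => hyF (hFG p.1 y (h ▸ p.2.2))
  obtain ⟨ε₃, hε₃, hε₃'⟩ := exists_pos_le_of_finite
    (d := fun p : {p : G × G // p.1 ≠ p.2} => TropDist.tdist (p.1.1 • y) (p.1.2 • y)) fun p =>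
      M.tdist_pos (hyV _) fun h => p.2 (hfree _ _ h)
  obtain ⟨r, hr, hrlt⟩ := ENNReal.lt_iff_exists_nnreal_btwn.1
    (lt_min (lt_min hε₁ hε₂) hε₃)
  rw [lt_min_iff, lt_min_iff] at hrlt
  obtain ⟨⟨hr₁, hr₂⟩, hr₃⟩ := hrlt
  have hr0 : (0 : ℝ) < r := by exact_mod_cast hr
  -- Half of `r`, so that orbit points are at least `2ε` apart.
  set ε : ℝ := r / 2 with hεdef
  have hε : 0 < ε := half_pos hr0
  have hεr : ENNReal.ofReal ε ≤ r := by
    rw [← ENNReal.ofReal_coe_nnreal]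
    exact ENNReal.ofReal_le_ofReal (by linarith)
  have h2ε : ENNReal.ofReal (2 * ε) = r := by
    rw [hεdef, mul_div_cancel₀ _ two_ne_zero, ENNReal.ofReal_coe_nnreal]
  have hfar : ∀ (g k : G) (x : Γ), TropDist.tdist x (g • y) < ENNReal.ofReal ε →
      k • x ∉ pointsAtInfinity Γ := fun g k x hx h =>
    absurd (hε₂' (g, ⟨x, hFG k x (hinf _ h)⟩)) (not_le.2 ((hx.trans_le hεr).trans hr₂))
  have hcard := fun M : Model Γ => card_fixingSubgroup_edge hfin M.toPreModel H
  set f : Γ → EReal := fun x => -((min (ENNReal.ofReal ε)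
    (⨅ h : H, TropDist.tdist x (h • y)) : ℝ≥0∞) : EReal) with hf
  have hfchip : ∀ M : Model Γ, f = @chipFiring _ (M.quotientDist H) {quotientMap H y}
      (ENNReal.ofReal ε) ∘ quotientMap H := by
    intro M'
    funext x
    simp only [hf, Function.comp, chipFiring, iInf_singleton]
    exact congrArg (fun r : ℝ≥0∞ => -(r : EReal))
      (min_quotientDist hG M' (hcard M') hfar hy x).symm
  have hf0 : ∀ x, f x = 0 → ∃ h : H, x = h • y := by
    intro x hx
    by_contra! hne
    obtain ⟨η, hη, hη'⟩ := exists_pos_le_of_finite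
      (d := fun h : H => TropDist.tdist x (h • y)) fun h => M.tdist_pos (hyV h) (hne h)
    simp only [hf, EReal.neg_eq_zero_iff, EReal.coe_ennreal_eq_zero] at hx
    exact (lt_min (ENNReal.ofReal_pos.2 hε) (hη.trans_le (le_iInf hη'))).ne' hx
  refine ⟨f, ?_, ?_, y, by simpa using hy 1, ENNReal.ofReal ε, ENNReal.ofReal_pos.2 hε, hfchip⟩
  · have := neg_min_iInf_tdist_mem_Rat M hε (ι := H) (e := fun h => e h) (s := fun h => s h)
      (fun h => hs h) (fun h => (hεr.trans hr₁.le).trans ((hε₁' h).trans (hδ₁ h)))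
      (fun h => (hεr.trans hr₁.le).trans ((hε₁' h).trans (hδ₂ h))) (fun h k hhk => by
        simp only [hes, h2ε]
        exact hr₃.le.trans (hε₃' ⟨(h, k), fun h' => hhk (Subtype.ext h')⟩))
    simpa only [hes] using! this
  · ext g
    rw [mem_functionStabilizer]
    constructor
    · intro hg
      have hy0 : f y = 0 := by
        have : (⨅ h : H, TropDist.tdist y (h • y)) = 0 := by
          refine le_antisymm (iInf_le_of_le 1 ?_) zero_le
          rw [one_smul, M.tdist_self]
        simp [hf, this]
      obtain ⟨h, hh⟩ := hf0 (g⁻¹ • y) ((hg y).trans hy0)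
      rw [← inv_mem_iff, hfree g⁻¹ h hh]
      exact h.2
    · intro hg x
      rw [hfchip M]
      exact congrArg (@chipFiring _ (M.quotientDist H) {quotientMap H y} (ENNReal.ofReal ε))
        (quotientMap_smul H ⟨g⁻¹, inv_mem hg⟩ x)

/-- The zero function serves, with the radius `1` chosen arbitrarily. An edge would contain
infinitely many points, so there is none, and hence no point at infinity. -/
lemma exists_rat_of_subsingleton [TropicalCurve Γ] [Subsingleton Γ] [Subsingleton G]
    (H : Subgroup G) :
    ∃ f ∈ Rat Γ, functionStabilizer G f = H ∧
      ∃ y ∉ pointsAtInfinity Γ, ∃ ε : ℝ≥0∞, 0 < ε ∧ ∀ M : Model Γ,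
        f = @chipFiring _ (M.quotientDist H) {quotientMap H y} ε ∘ quotientMap H := by
  obtain ⟨M⟩ := TropicalCurve.nonempty_model (Γ := Γ)
  obtain ⟨y⟩ := (inferInstance : Nonempty Γ)
  refine ⟨fun _ => 0, zero_mem_Rat M, Subsingleton.elim _ _, y, ?_, 1, one_pos, fun M' => ?_⟩
  · rintro ⟨M', e, -⟩
    exact M'.infinite_edge e (Set.toFinite _)
  · funext x
    obtain rfl := Subsingleton.elim x y
    have : (M'.quotientDist H).tdist (quotientMap H x) (quotientMap H x) = 0 :=
      le_antisymm (sInf_le (.nil _)) zero_le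
    simp only [Function.comp, chipFiring, iInf_singleton]
    rw [this]
    simp

end main

end Trop

/-- If `φ : Γ → Γ'` is `G`-Galois, every subgroup `H` of `G` is the stabilizer of a rational
function on `Γ`, and this function can be taken to be the pull-back of a chip-firing move
`CF({π_H y}, ε)` on the quotient tropical curve `Γ / H`. -/
theorem mainTheorem6 {Γ Γ' G : Type*}
    [TopologicalSpace Γ] [Trop.TropDist Γ] [Trop.TropicalCurve Γ]
    [TopologicalSpace Γ'] [Trop.TropDist Γ'] [Trop.TropicalCurve Γ']
    [Group G] [Finite G] [MulAction G Γ] (hG : Trop.IsometricAction G Γ)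
    (hΓ : Nontrivial Γ ∨ Subsingleton G)
    (φ : Γ → Γ') (hφ : Trop.IsGalois G φ) (H : Subgroup G) :
    ∃ f ∈ Trop.Rat Γ, Trop.functionStabilizer G f = H ∧
      ∃ y ∉ Trop.pointsAtInfinity Γ, ∃ ε : ℝ≥0∞, 0 < ε ∧ ∀ M : Trop.Model Γ,
        f = @Trop.chipFiring _ (M.quotientDist H) {Trop.quotientMap H y} ε ∘
          Trop.quotientMap H := by
  rcases subsingleton_or_nontrivial Γ with hΓ' | hΓ'
  · have : Subsingleton G := hΓ.resolve_left (not_nontrivial_iff_subsingleton.2 hΓ')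
    exact Trop.exists_rat_of_subsingleton H
  · exact Trop.exists_rat_of_nontrivial hG hφ.finite_stabilizer H
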